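/- Let $q$ be a complex number with $|q|<1$. Write $(a;q)_\infty=\prod_{k\ge 0}(1-aq^k)$, $(a;q)_n=\prod_{k=0}^{n-1}(1-aq^k)$ for integers $n\ge 0$, and $(a,b;q)_\infty=(a;q)_\infty(b;q)_\infty$ (and likewise with $q$ replaced by $q^2$ or $q^{10}$). Then both double series below converge absolutely, and $$\sum_{i,j\ge 0}\frac{q^{2ij+i+j}}{(q;q)_{2i}(q;q)_{2j}}=\frac{1}{(q;q^2)_\infty^2\,(q^2,q^8;q^{10})_\infty},$$ $$\sum_{i,j\ge 0}\frac{q^{2ij+i+3j}}{(q;q)_{2i+1}(q;q)_{2j}}=\frac{1}{(q;q^2)_\infty^2\,(q^4,q^6;q^{10})_\infty}.$$ -/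

import Mathlib

/-- The finite `q`-shifted factorial `(a; q)_n = ∏_{k=0}^{n-1} (1 - a q^k)`, for `n ≥ 0`. -/
noncomputable def qPoch (a q : ℂ) (n : ℕ) : ℂ :=
  ∏ k ∈ Finset.range n, (1 - a * q ^ k)

/-- The infinite `q`-shifted factorial `(a; q)_∞ = ∏_{k=0}^∞ (1 - a q^k)`, used for `|q| < 1`. -/
noncomputable def qPochInf (a q : ℂ) : ℂ :=
  ∏' k : ℕ, (1 - a * q ^ k)

/-- The infinite product defining `(a; q)_∞` converges for `|q| < 1`. -/
theorem qPochInf_multipliable (a : ℂ) {q : ℂ} (hq : ‖q‖ < 1) :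
    Multipliable fun k : ℕ => 1 - a * q ^ k := by
  have h : Summable fun k : ℕ => ‖-(a * q ^ k)‖ := by
    simpa [norm_mul, norm_pow] using
      (summable_geometric_of_lt_one (norm_nonneg q) hq).mul_left ‖a‖
  simpa [sub_eq_add_neg] using multipliable_one_add_of_summable h

/-- `(a; q)_∞ ≠ 0` when `|q| < 1` and no factor vanishes. -/
theorem qPochInf_ne_zero (a : ℂ) {q : ℂ} (hq : ‖q‖ < 1) (h0 : ∀ k : ℕ, 1 - a * q ^ k ≠ 0) :
    qPochInf a q ≠ 0 := by
  have h : Summable fun k : ℕ => ‖-(a * q ^ k)‖ := by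
    simpa [norm_mul, norm_pow] using
      (summable_geometric_of_lt_one (norm_nonneg q) hq).mul_left ‖a‖
  simpa [qPochInf, sub_eq_add_neg] using
    tprod_one_add_ne_zero_of_summable (f := fun k : ℕ => -(a * q ^ k))
      (by simpa [sub_eq_add_neg] using h0) h

/-- `(a; q)_n = (a; q)_∞ / (a q^n; q)_∞` whenever the denominator is nonzero. -/
theorem qPoch_eq_div (a : ℂ) {q : ℂ} (hq : ‖q‖ < 1) (n : ℕ)
    (hn : qPochInf (a * q ^ n) q ≠ 0) :
    qPoch a q n = qPochInf a q / qPochInf (a * q ^ n) q := by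
  have hs : (fun k : ℕ => 1 - a * q ^ (k + n)) = fun k : ℕ => 1 - a * q ^ n * q ^ k := by
    funext k
    ring
  have hm : Multipliable fun k : ℕ => 1 - a * q ^ (k + n) := by
    rw [hs]
    exact qPochInf_multipliable _ hq
  have h := Multipliable.prod_mul_tprod_nat_mul' (f := fun k : ℕ => 1 - a * q ^ k) hm
  rw [hs] at h
  rw [eq_div_iff hn]
  exact h

/-! Choose `b` with `b ^ 2 = q`. For fixed `j`, the sum over `i` is the even (resp. odd) part in `b`
of Euler's series for `1 / (b q^j; q)_∞`. Since `(b q^j; q)_∞ (-b q^j; q)_∞ = (q^(2j+1); q^2)_∞`,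
dividing by `(q; q)_{2j}` turns that reciprocal into `(-b q^j; q)_∞ / (q^2; q^2)_j`, up to the
constant `1 / (q; q^2)_∞` (`inv_qPoch_mul_inv_qPochInf`). Expanding the numerator by Euler's other
series and summing over `j` first (`exists_hasSum_qPochInf_series`) leaves a single series in `b`.
Its even or odd part is a second `1 / (q; q^2)_∞` times a Rogers–Ramanujan sum in base `q^2`.

The Rogers–Ramanujan identities come from the functional equation `G(z) = G(zq) + z G(zq^2)`. Both
the sum side and a Rogers–Selberg series divided by `(z; q)_∞` satisfy it along `z = q^(n+1)` and
tend to 1, so they agree (`ramanujanSeries_pow_eq`). At `a = q` the Rogers–Selberg series are theta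
series, which the Jacobi triple product evaluates. -/

open Filter Topology

/-! ### Elementary properties of `q`-shifted factorials -/

theorem norm_mul_pow_lt_one {a q : ℂ} (hq : ‖q‖ < 1) (ha : ‖a‖ < 1) (k : ℕ) :
    ‖a * q ^ k‖ < 1 := by
  rw [norm_mul, norm_pow]
  exact (mul_le_of_le_one_right (norm_nonneg a) (pow_le_one₀ (norm_nonneg q) hq.le)).trans_lt ha

theorem one_sub_mul_pow_ne_zero {a q : ℂ} (hq : ‖q‖ < 1) (ha : ‖a‖ < 1) (k : ℕ) :
    1 - a * q ^ k ≠ 0 := by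
  intro h
  have h1 : a * q ^ k = 1 := (sub_eq_zero.mp h).symm
  have h2 := norm_mul_pow_lt_one hq ha k
  rw [h1, norm_one] at h2
  exact lt_irrefl _ h2

theorem qPoch_ne_zero {a q : ℂ} (hq : ‖q‖ < 1) (ha : ‖a‖ < 1) (n : ℕ) : qPoch a q n ≠ 0 :=
  Finset.prod_ne_zero_iff.mpr fun k _ => one_sub_mul_pow_ne_zero hq ha k

theorem qPochInf_ne_zero_of_norm_lt_one {a q : ℂ} (hq : ‖q‖ < 1) (ha : ‖a‖ < 1) :
    qPochInf a q ≠ 0 :=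
  qPochInf_ne_zero a hq (one_sub_mul_pow_ne_zero hq ha)

theorem qPoch_zero (a q : ℂ) : qPoch a q 0 = 1 := by simp [qPoch]

theorem qPoch_succ (a q : ℂ) (n : ℕ) : qPoch a q (n + 1) = qPoch a q n * (1 - a * q ^ n) := by
  simp [qPoch, Finset.prod_range_succ]

theorem qPoch_succ' (a q : ℂ) (n : ℕ) : qPoch a q (n + 1) = (1 - a) * qPoch (a * q) q n := by
  rw [qPoch, Finset.prod_range_succ', mul_comm, qPoch]
  congr 1
  · simp
  · exact Finset.prod_congr rfl fun k _ => by ring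

theorem qPoch_self_succ (q : ℂ) (n : ℕ) :
    qPoch q q (n + 1) = qPoch q q n * (1 - q ^ (n + 1)) := by
  rw [qPoch_succ, pow_succ']

theorem tendsto_qPoch (a : ℂ) {q : ℂ} (hq : ‖q‖ < 1) :
    Tendsto (qPoch a q) atTop (𝓝 (qPochInf a q)) :=
  (qPochInf_multipliable a hq).hasProd.tendsto_prod_nat

theorem qPoch_mul_qPochInf (a : ℂ) {q : ℂ} (hq : ‖q‖ < 1) (n : ℕ) :
    qPoch a q n * qPochInf (a * q ^ n) q = qPochInf a q := by
  have hs : (fun k : ℕ => 1 - a * q ^ (k + n)) = fun k : ℕ => 1 - a * q ^ n * q ^ k := by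
    funext k
    ring
  have hm : Multipliable fun k : ℕ => 1 - a * q ^ (k + n) := by
    rw [hs]
    exact qPochInf_multipliable _ hq
  have h := Multipliable.prod_mul_tprod_nat_mul' (f := fun k : ℕ => 1 - a * q ^ k) hm
  rwa [hs] at h

theorem qPochInf_eq_one_sub_mul (a : ℂ) {q : ℂ} (hq : ‖q‖ < 1) :
    qPochInf a q = (1 - a) * qPochInf (a * q) q := by
  simpa [qPoch] using (qPoch_mul_qPochInf a hq 1).symm

theorem qPochInf_mul_neg (b : ℂ) {q : ℂ} (hq : ‖q‖ < 1) :
    qPochInf b q * qPochInf (-b) q = qPochInf (b ^ 2) (q ^ 2) := by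
  rw [qPochInf, qPochInf, ← (qPochInf_multipliable b hq).tprod_mul (qPochInf_multipliable (-b) hq)]
  exact tprod_congr fun k => by ring

/-- The factors are sorted by exponent modulo `m`; raising `n` by one adds a block of `m`
consecutive factors, one for each residue. -/
theorem qPoch_mul_index (a q : ℂ) (m n : ℕ) :
    qPoch a q (m * n) = ∏ i ∈ Finset.range m, qPoch (a * q ^ i) (q ^ m) n := by
  induction n with
  | zero => simp [qPoch]
  | succ n ih =>
    simp only [qPoch_succ, Finset.prod_mul_distrib, ← ih]
    rw [mul_add, mul_one, qPoch, Finset.prod_range_add, ← qPoch]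
    congr 1
    exact Finset.prod_congr rfl fun k _ => by ring

theorem qPoch_two_mul (q : ℂ) (n : ℕ) :
    qPoch q q (2 * n) = qPoch q (q ^ 2) n * qPoch (q ^ 2) (q ^ 2) n := by
  rw [qPoch_mul_index, Finset.prod_range_succ, Finset.prod_range_one, pow_zero, mul_one, pow_one,
    ← pow_two]

theorem qPoch_two_mul_add_one (q : ℂ) (n : ℕ) :
    qPoch q q (2 * n + 1) = qPoch q (q ^ 2) (n + 1) * qPoch (q ^ 2) (q ^ 2) n := by
  rw [qPoch_succ, qPoch_two_mul, qPoch_succ]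
  ring

theorem qPochInf_eq_prod (a : ℂ) {q : ℂ} (hq : ‖q‖ < 1) {m : ℕ} (hm : 0 < m) :
    qPochInf a q = ∏ i ∈ Finset.range m, qPochInf (a * q ^ i) (q ^ m) := by
  have hqm : ‖q ^ m‖ < 1 := by
    rw [norm_pow]
    exact pow_lt_one₀ (norm_nonneg q) hq hm.ne'
  have h1 : Tendsto (fun n => qPoch a q (m * n)) atTop (𝓝 (qPochInf a q)) :=
    (tendsto_qPoch a hq).comp (tendsto_id.const_mul_atTop' hm)
  have h2 : Tendsto (fun n => ∏ i ∈ Finset.range m, qPoch (a * q ^ i) (q ^ m) n) atTop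
      (𝓝 (∏ i ∈ Finset.range m, qPochInf (a * q ^ i) (q ^ m))) :=
    tendsto_finsetProd _ fun i _ => tendsto_qPoch _ hqm
  simp only [← qPoch_mul_index] at h2
  exact tendsto_nhds_unique h1 h2

theorem exists_norm_qPoch_le (a : ℂ) {q : ℂ} (hq : ‖q‖ < 1) :
    ∃ C, 0 < C ∧ ∀ n, ‖qPoch a q n‖ ≤ C := by
  obtain ⟨C, hC⟩ := (Metric.isBounded_range_of_tendsto _ (tendsto_qPoch a hq)).exists_norm_le
  exact ⟨max C 1, by positivity, fun n => (hC _ ⟨n, rfl⟩).trans (le_max_left _ _)⟩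

theorem exists_norm_qPoch_inv_le {a q : ℂ} (hq : ‖q‖ < 1) (ha : ‖a‖ < 1) :
    ∃ C, 0 < C ∧ ∀ n, ‖(qPoch a q n)⁻¹‖ ≤ C := by
  obtain ⟨C, hC⟩ := (Metric.isBounded_range_of_tendsto _
    ((tendsto_qPoch a hq).inv₀ (qPochInf_ne_zero_of_norm_lt_one hq ha))).exists_norm_le
  exact ⟨max C 1, by positivity, fun n => (hC _ ⟨n, rfl⟩).trans (le_max_left _ _)⟩

theorem tendsto_qPochInf_mul_pow (a : ℂ) {q : ℂ} (hq : ‖q‖ < 1) (h0 : qPochInf a q ≠ 0) :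
    Tendsto (fun n => qPochInf (a * q ^ n) q) atTop (𝓝 1) := by
  have h := (tendsto_const_nhds (x := qPochInf a q)).div (tendsto_qPoch a hq) h0
  rw [div_self h0] at h
  refine h.congr fun n => ?_
  have := qPoch_mul_qPochInf a hq n
  rw [Pi.div_apply, ← this, mul_div_cancel_left₀]
  rintro h
  rw [h, zero_mul] at this
  exact h0 this.symm

/-! ### Euler's two expansions -/

theorem summable_norm_pow_mul_pow_choose {q : ℂ} (hq : ‖q‖ < 1) (z : ℂ) :
    Summable fun n : ℕ => ‖z ^ n * q ^ n.choose 2‖ := by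
  rcases eq_or_ne z 0 with rfl | hz
  · refine summable_of_ne_finset_zero (s := {0}) fun n hn => ?_
    simp [show n ≠ 0 by simpa using hn]
  rcases eq_or_ne q 0 with rfl | hq0
  · refine summable_of_ne_finset_zero (s := {0, 1}) fun n hn => ?_
    have : 2 ≤ n := by
      simp at hn
      omega
    simp [(Nat.choose_pos this).ne']
  refine summable_of_ratio_test_tendsto_lt_one (l := 0) zero_lt_one
    (Eventually.of_forall fun n => norm_ne_zero_iff.mpr
      (mul_ne_zero (pow_ne_zero _ hz) (pow_ne_zero _ hq0))) ?_
  have h : Tendsto (fun n => ‖z‖ * ‖q‖ ^ n) atTop (𝓝 (‖z‖ * 0)) :=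
    (tendsto_pow_atTop_nhds_zero_of_lt_one (norm_nonneg q) hq).const_mul _
  rw [mul_zero] at h
  refine h.congr fun n => ?_
  have h1 : (n + 1).choose 2 = n + n.choose 2 := by simp [Nat.choose_succ_succ' n 1]
  simp only [norm_norm, norm_mul, norm_pow, h1]
  rw [eq_div_iff (mul_ne_zero (pow_ne_zero _ (norm_ne_zero_iff.mpr hz))
    (pow_ne_zero _ (norm_ne_zero_iff.mpr hq0)))]
  ring

/-- A power series with absolutely summable terms on the unit disc is continuous at `0` along
`z q ^ n`. -/
theorem tendsto_tsum_mul_pow {c : ℕ → ℂ} {q z : ℂ} (hq : ‖q‖ < 1)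
    (hs : Summable fun k => ‖z ^ k * c k‖) :
    Tendsto (fun n : ℕ => ∑' k, (z * q ^ n) ^ k * c k) atTop (𝓝 (c 0)) := by
  have h0 : ∑' k : ℕ, (if k = 0 then c 0 else 0) = c 0 := tsum_ite_eq 0 _
  rw [← h0]
  refine tendsto_tsum_of_dominated_convergence hs (fun k => ?_)
    (Eventually.of_forall fun n k => ?_)
  · rcases eq_or_ne k 0 with rfl | hk
    · simp
    · rw [if_neg hk]
      have h1 : Tendsto (fun n : ℕ => (z * q ^ n) ^ k * c k) atTop (𝓝 ((z * 0) ^ k * c k)) :=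
        (((tendsto_pow_atTop_nhds_zero_of_norm_lt_one hq).const_mul z).pow k).mul_const _
      simpa [hk] using h1
  · rw [mul_pow, norm_mul, norm_mul, norm_mul]
    gcongr
    refine mul_le_of_le_one_right (norm_nonneg _) ?_
    rw [norm_pow, norm_pow]
    exact pow_le_one₀ (by positivity) (pow_le_one₀ (norm_nonneg q) hq.le)

theorem summable_norm_pow_div_qPoch {q z : ℂ} (hq : ‖q‖ < 1) (hz : ‖z‖ < 1) :
    Summable fun n : ℕ => ‖z ^ n * (qPoch q q n)⁻¹‖ := by
  obtain ⟨C, -, hC⟩ := exists_norm_qPoch_inv_le hq hq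
  refine Summable.of_nonneg_of_le (fun _ => norm_nonneg _) (fun n => ?_)
    ((summable_geometric_of_lt_one (norm_nonneg z) hz).mul_right C)
  rw [norm_mul, norm_pow]
  exact mul_le_mul_of_nonneg_left (hC n) (by positivity)

theorem summable_norm_euler {q : ℂ} (hq : ‖q‖ < 1) (z : ℂ) :
    Summable fun n : ℕ => ‖z ^ n * (q ^ n.choose 2 * (qPoch q q n)⁻¹)‖ := by
  obtain ⟨C, -, hC⟩ := exists_norm_qPoch_inv_le hq hq
  refine Summable.of_nonneg_of_le (fun _ => norm_nonneg _) (fun n => ?_)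
    ((summable_norm_pow_mul_pow_choose hq z).mul_right C)
  rw [← mul_assoc, norm_mul]
  exact mul_le_mul_of_nonneg_left (hC n) (by positivity)

/-- Euler's expansion of `1 / (z; q)_∞`. -/
theorem hasSum_pow_div_qPoch {q z : ℂ} (hq : ‖q‖ < 1) (hz : ‖z‖ < 1) :
    HasSum (fun n : ℕ => z ^ n * (qPoch q q n)⁻¹) (qPochInf z q)⁻¹ := by
  have hzq : ∀ n, ‖z * q ^ n‖ < 1 := norm_mul_pow_lt_one hq hz
  set f : ℂ → ℂ := fun w => ∑' n : ℕ, w ^ n * (qPoch q q n)⁻¹ with hf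
  -- Functional equation: the factor `1 - q ^ n` in `f w - f (w * q)` removes the last factor of
  -- `(q; q)_n`, which shifts the index. Iterating pushes the argument to 0, where `f` tends to 1.
  have hstep : ∀ w : ℂ, ‖w‖ < 1 → ‖w * q‖ < 1 → f w * (1 - w) = f (w * q) := fun w hw hwq => by
    have s1 := (summable_norm_pow_div_qPoch hq hw).of_norm
    have s2 := (summable_norm_pow_div_qPoch hq hwq).of_norm
    have h1 : f w - f (w * q) = ∑' n : ℕ, (w ^ n * (1 - q ^ n) * (qPoch q q n)⁻¹) := by
      rw [hf]
      dsimp only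
      rw [← s1.tsum_sub s2]
      exact tsum_congr fun n => by ring
    have s3 : Summable fun n : ℕ => w ^ n * (1 - q ^ n) * (qPoch q q n)⁻¹ :=
      (s1.sub s2).congr fun n => by ring
    have h2 : f w - f (w * q) = w * f w := by
      rw [h1, s3.tsum_eq_zero_add, hf, ← tsum_mul_left]
      simp only [pow_zero, sub_self, mul_zero, zero_mul, zero_add]
      refine tsum_congr fun n => ?_
      have := qPoch_ne_zero hq hq (n + 1)
      rw [qPoch_self_succ] at this ⊢
      have h3 := left_ne_zero_of_mul this
      have h4 := right_ne_zero_of_mul this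
      field_simp
      ring
    linear_combination h2
  have hiter : ∀ n, f z * qPoch z q n = f (z * q ^ n) := fun n => by
    induction n with
    | zero => simp [qPoch_zero]
    | succ n ih =>
      rw [qPoch_succ, ← mul_assoc, ih, hstep _ (hzq n) (by rw [mul_assoc, ← pow_succ]; exact hzq _),
        mul_assoc, ← pow_succ]
  have h1 := (tendsto_qPoch z hq).const_mul (f z)
  simp only [hiter] at h1
  have h2 := tendsto_nhds_unique h1
    (tendsto_tsum_mul_pow hq (summable_norm_pow_div_qPoch hq hz))
  rw [qPoch_zero, inv_one] at h2
  rw [← eq_inv_of_mul_eq_one_left h2]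
  exact (summable_norm_pow_div_qPoch hq hz).of_norm.hasSum

/-- Euler's expansion of `(-z; q)_∞`. -/
theorem hasSum_qPochInf_neg {q : ℂ} (hq : ‖q‖ < 1) (z : ℂ) :
    HasSum (fun n : ℕ => z ^ n * (q ^ n.choose 2 * (qPoch q q n)⁻¹)) (qPochInf (-z) q) := by
  set f : ℂ → ℂ := fun w => ∑' n : ℕ, w ^ n * (q ^ n.choose 2 * (qPoch q q n)⁻¹) with hf
  -- The same index shift; `(n + 1).choose 2 = n + n.choose 2` supplies the extra `q ^ n` that moves
  -- the argument on the right to `w * q`.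
  have hstep : ∀ w : ℂ, f w = (1 + w) * f (w * q) := fun w => by
    have s1 := (summable_norm_euler hq w).of_norm
    have s2 := (summable_norm_euler hq (w * q)).of_norm
    have s3 : Summable fun n : ℕ => w ^ n * (1 - q ^ n) * (q ^ n.choose 2 * (qPoch q q n)⁻¹) :=
      (s1.sub s2).congr fun n => by ring
    have h2 : f w - f (w * q) = w * f (w * q) := by
      have h1 : f w - f (w * q) =
          ∑' n : ℕ, (w ^ n * (1 - q ^ n) * (q ^ n.choose 2 * (qPoch q q n)⁻¹)) := by
        rw [hf]
        dsimp only
        rw [← s1.tsum_sub s2]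
        exact tsum_congr fun n => by ring
      rw [h1, s3.tsum_eq_zero_add, hf, ← tsum_mul_left]
      simp only [pow_zero, sub_self, mul_zero, zero_mul, zero_add]
      refine tsum_congr fun n => ?_
      have := qPoch_ne_zero hq hq (n + 1)
      rw [qPoch_self_succ] at this ⊢
      have h3 := left_ne_zero_of_mul this
      have h4 := right_ne_zero_of_mul this
      have h5 : (n + 1).choose 2 = n + n.choose 2 := by simp [Nat.choose_succ_succ' n 1]
      rw [h5]
      field_simp
      ring
    linear_combination h2
  have hiter : ∀ n, f z = qPoch (-z) q n * f (z * q ^ n) := fun n => by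
    induction n with
    | zero => simp [qPoch_zero]
    | succ n ih =>
      rw [ih, hstep (z * q ^ n), qPoch_succ]
      ring_nf
  have h1 := (tendsto_qPoch (-z) hq).mul
    (tendsto_tsum_mul_pow hq (summable_norm_euler hq z))
  have h2 := tendsto_nhds_unique (tendsto_const_nhds.congr hiter) h1
  simp only [Nat.choose_zero_succ, pow_zero, qPoch_zero, inv_one, mul_one] at h2
  rw [← h2]
  exact (summable_norm_euler hq z).of_norm.hasSum

/-! ### The Jacobi triple product -/

theorem Int.two_mul_mul_sub_one_ediv_two (n : ℤ) : 2 * (n * (n - 1) / 2) = n * (n - 1) :=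
  Int.mul_ediv_cancel' (Int.even_mul_pred_self n).two_dvd

theorem Nat.cast_choose_two_int (m : ℕ) : ((m.choose 2 : ℕ) : ℤ) = (m : ℤ) * (m - 1) / 2 := by
  rw [Nat.choose_two_right]
  rcases m with _ | m <;> simp

/-- The general term of the theta series `∑ (-1)^n x^n q^(n(n-1)/2)`. -/
noncomputable def thetaTerm (q x : ℂ) (n : ℤ) : ℂ := (-1) ^ n * x ^ n * q ^ (n * (n - 1) / 2)

theorem thetaTerm_natCast (q x : ℂ) (n : ℕ) :
    thetaTerm q x n = (-x) ^ n * q ^ n.choose 2 := by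
  simp only [thetaTerm, ← Nat.cast_choose_two_int, zpow_natCast, neg_pow x]

theorem thetaTerm_neg_natCast {q : ℂ} (hq0 : q ≠ 0) (x : ℂ) (n : ℕ) :
    thetaTerm q x (-n) = (-(q / x)) ^ n * q ^ n.choose 2 := by
  have h1 : (-n : ℤ) * (-n - 1) / 2 = n + (n.choose 2 : ℕ) := by
    have h2 := Int.two_mul_mul_sub_one_ediv_two (-n)
    have h3 := Int.two_mul_mul_sub_one_ediv_two n
    rw [Nat.cast_choose_two_int]
    linarith
  simp only [thetaTerm, h1, zpow_add₀ hq0, zpow_natCast, neg_pow (q / x), zpow_neg, div_pow,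
    ← inv_pow, inv_neg_one]
  ring

theorem summable_norm_thetaTerm {q : ℂ} (hq : ‖q‖ < 1) (hq0 : q ≠ 0) (x : ℂ) :
    Summable fun n => ‖thetaTerm q x n‖ := by
  refine Summable.of_nat_of_neg ?_ ?_
  · simpa only [thetaTerm_natCast] using summable_norm_pow_mul_pow_choose hq (-x)
  · simpa only [thetaTerm_neg_natCast hq0] using summable_norm_pow_mul_pow_choose hq (-(q / x))

/-- The quadratic exponent splits into its value at `-N`, a cross term and `m.choose 2`, while the
powers of `x` depending on `m` cancel. The sum over `m` is therefore an Euler series free of `x`. -/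
theorem thetaTerm_neg_sub_mul_pow {q x : ℂ} (hq0 : q ≠ 0) (hx0 : x ≠ 0) (N : ℤ) (m : ℕ) :
    thetaTerm q x (-N - m) * x ^ m =
      thetaTerm q x (-N) * ((-(q ^ (N + 1))) ^ m * q ^ m.choose 2) := by
  have h1 : (-N - m) * (-N - m - 1) / 2 =
      -N * (-N - 1) / 2 + (N + 1) * m + (m.choose 2 : ℕ) := by
    have h2 := Int.two_mul_mul_sub_one_ediv_two (-N)
    have h3 := Int.two_mul_mul_sub_one_ediv_two (-N - m)
    have h4 := Int.two_mul_mul_sub_one_ediv_two m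
    rw [Nat.cast_choose_two_int]
    linarith
  have h5 : ((-1 : ℂ) ^ m)⁻¹ = (-1) ^ m := by rw [← inv_pow, inv_neg_one]
  have h6 : (x ^ m)⁻¹ * x ^ m = 1 := inv_mul_cancel₀ (pow_ne_zero m hx0)
  rw [thetaTerm, h1, zpow_sub₀ (by norm_num), zpow_sub₀ hx0, zpow_add₀ hq0, zpow_add₀ hq0,
    zpow_mul, neg_pow (q ^ (N + 1)), thetaTerm]
  simp only [zpow_natCast]
  rw [div_eq_mul_inv, div_eq_mul_inv, h5]
  linear_combination ((-1) ^ (-N) * (-1) ^ m * x ^ (-N) * q ^ (-N * (-N - 1) / 2) *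
    (q ^ (N + 1)) ^ m * q ^ m.choose 2) * h6

theorem hasSum_thetaTerm_mul {q x : ℂ} (hq : ‖q‖ < 1) (hq0 : q ≠ 0) (hx0 : x ≠ 0) (N : ℤ) :
    HasSum (fun m : ℕ => thetaTerm q x (-N - m) * (x ^ m * (qPoch q q m)⁻¹))
      (thetaTerm q x (-N) * qPochInf (q ^ (N + 1)) q) := by
  have h := (hasSum_qPochInf_neg hq (-(q ^ (N + 1)))).mul_left (thetaTerm q x (-N))
  rw [neg_neg] at h
  refine h.congr_fun fun m => ?_
  linear_combination (qPoch q q m)⁻¹ * thetaTerm_neg_sub_mul_pow hq0 hx0 N m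

theorem qPochInf_zpow_eq_zero {q : ℂ} (hq : ‖q‖ < 1) (hq0 : q ≠ 0) {N : ℤ}
    (hN : N ∉ Set.range ((↑) : ℕ → ℤ)) : qPochInf (q ^ (N + 1)) q = 0 := by
  have hN0 : N < 0 := by
    by_contra h
    exact hN ⟨N.toNat, by omega⟩
  obtain ⟨k, rfl⟩ : ∃ k : ℕ, N = -1 - k := ⟨(-1 - N).toNat, by omega⟩
  rw [← qPoch_mul_qPochInf _ hq (k + 1), qPoch_succ]
  have : q ^ (-1 - (k : ℤ) + 1) * q ^ k = 1 := by
    rw [← zpow_natCast, ← zpow_add₀ hq0, show -1 - (k : ℤ) + 1 + k = 0 by ring, zpow_zero]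
  rw [this, sub_self, mul_zero, zero_mul]

/-- For `N < 0` the product `(q^(N+1); q)_∞` contains a zero factor. For `N ≥ 0` it is `(q; q)_∞ /
(q; q)_N`, so Euler's expansion applies once more. -/
theorem hasSum_thetaTerm_neg_mul_qPochInf {q : ℂ} (hq : ‖q‖ < 1) (hq0 : q ≠ 0) (x : ℂ) :
    HasSum (fun N : ℤ => thetaTerm q x (-N) * qPochInf (q ^ (N + 1)) q)
      (qPochInf q q * qPochInf (q / x) q) := by
  rw [← Nat.cast_injective.hasSum_iff
    fun N hN => by rw [qPochInf_zpow_eq_zero hq hq0 hN, mul_zero]]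
  have h := (hasSum_qPochInf_neg hq (-(q / x))).mul_left (qPochInf q q)
  rw [neg_neg] at h
  refine h.congr_fun fun n => ?_
  have h1 : q ^ ((n : ℤ) + 1) = q * q ^ n := by
    rw [zpow_add_one₀ hq0, zpow_natCast, mul_comm]
  have h2 := qPoch_ne_zero hq hq n
  simp only [Function.comp_apply, thetaTerm_neg_natCast hq0, h1]
  rw [← qPoch_mul_qPochInf q hq n]
  field_simp

/-- The involution `(n, m) ↦ (-n - m, m)` of `ℤ × ℕ`. -/
def negSubEquiv : ℤ × ℕ ≃ ℤ × ℕ where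
  toFun p := (-p.1 - p.2, p.2)
  invFun p := (-p.1 - p.2, p.2)
  left_inv p := by ext <;> simp
  right_inv p := by ext <;> simp

/-- **Jacobi triple product**, for `0 < |x| < 1`. -/
theorem hasSum_jacobi_triple {q x : ℂ} (hq : ‖q‖ < 1) (hq0 : q ≠ 0) (hx : ‖x‖ < 1) (hx0 : x ≠ 0) :
    HasSum (thetaTerm q x) (qPochInf q q * (qPochInf x q * qPochInf (q / x) q)) := by
  have sθ := summable_norm_thetaTerm hq hq0 x
  have hs : Summable fun p : ℤ × ℕ => thetaTerm q x p.1 * (x ^ p.2 * (qPoch q q p.2)⁻¹) :=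
    summable_mul_of_summable_norm (f := thetaTerm q x) (g := fun m => x ^ m * (qPoch q q m)⁻¹)
      sθ (summable_norm_pow_div_qPoch hq hx)
  have hprod : HasSum (fun p : ℤ × ℕ => thetaTerm q x p.1 * (x ^ p.2 * (qPoch q q p.2)⁻¹))
      ((∑' n, thetaTerm q x n) * (qPochInf x q)⁻¹) :=
    HasSum.mul (f := thetaTerm q x) (g := fun m : ℕ => x ^ m * (qPoch q q m)⁻¹)
      sθ.of_norm.hasSum (hasSum_pow_div_qPoch hq hx) hs
  -- Theta series times Euler's series for `1 / (x; q)_∞`, regrouped by `N = -n - m`. Summing over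
  -- `m` and then over `N` gives `(q; q)_∞ (q / x; q)_∞`.
  have hprod' : HasSum (fun p : ℤ × ℕ =>
      thetaTerm q x (-p.1 - p.2) * (x ^ p.2 * (qPoch q q p.2)⁻¹))
      ((∑' n, thetaTerm q x n) * (qPochInf x q)⁻¹) := negSubEquiv.hasSum_iff.mpr hprod
  have hcol : HasSum (fun N : ℤ => thetaTerm q x (-N) * qPochInf (q ^ (N + 1)) q)
      ((∑' n, thetaTerm q x n) * (qPochInf x q)⁻¹) :=
    hprod'.prod_fiberwise fun N => hasSum_thetaTerm_mul hq hq0 hx0 N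
  have heq := hcol.unique (hasSum_thetaTerm_neg_mul_qPochInf hq hq0 x)
  rw [mul_inv_eq_iff_eq_mul₀ (qPochInf_ne_zero_of_norm_lt_one hq hx)] at heq
  have hval : qPochInf q q * (qPochInf x q * qPochInf (q / x) q) = ∑' n, thetaTerm q x n := by
    rw [heq]
    ring
  rw [hval]
  exact sθ.of_norm.hasSum

/-! ### Rogers–Selberg series and the Rogers–Ramanujan recurrence -/

theorem norm_pow_succ_lt_one {q : ℂ} (hq : ‖q‖ < 1) (n : ℕ) : ‖q ^ (n + 1)‖ < 1 := by
  rw [norm_pow]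
  exact pow_lt_one₀ (norm_nonneg q) hq n.succ_ne_zero

theorem Nat.succ_choose_two (n : ℕ) : (n + 1).choose 2 = n + n.choose 2 := by
  simp [Nat.choose_succ_succ' n 1]

/-- The common factor of the Rogers–Selberg series. -/
noncomputable def selbergFactor (q a : ℂ) (r : ℕ) : ℂ :=
  (-1) ^ r * a ^ (2 * r) * q ^ (5 * r.choose 2 + r) * qPoch a q r * (qPoch q q r)⁻¹

noncomputable def selbergOne (q a : ℂ) : ℂ :=
  ∑' r, selbergFactor q a r * (q ^ r * (1 - a * q ^ (2 * r)))

noncomputable def selbergTwo (q a : ℂ) : ℂ :=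
  ∑' r, selbergFactor q a r * (1 - a ^ 2 * q ^ (4 * r))

theorem selbergFactor_succ_mul {q : ℂ} (hq : ‖q‖ < 1) (a : ℂ) (r : ℕ) :
    selbergFactor q a (r + 1) * (1 - q ^ (r + 1)) =
      -(selbergFactor q a r * (a ^ 2 * q ^ (5 * r + 1) * (1 - a * q ^ r))) := by
  have h := qPoch_ne_zero hq hq (r + 1)
  rw [qPoch_self_succ] at h
  have h1 := left_ne_zero_of_mul h
  have h2 := right_ne_zero_of_mul h
  rw [selbergFactor, selbergFactor, qPoch_self_succ, qPoch_succ a, Nat.succ_choose_two]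
  field_simp
  ring

theorem one_sub_mul_selbergFactor (q a : ℂ) (r : ℕ) :
    (1 - a) * selbergFactor q (a * q) r =
      selbergFactor q a r * (q ^ (2 * r) * (1 - a * q ^ r)) := by
  have h := qPoch_succ' a q r
  rw [qPoch_succ] at h
  rw [selbergFactor, selbergFactor]
  linear_combination (-(-1) ^ r * (a * q) ^ (2 * r) * q ^ (5 * r.choose 2 + r) *
    (qPoch q q r)⁻¹) * h

theorem norm_selbergFactor_mul_le {q a w : ℂ} {A C B : ℝ} (hq : ‖q‖ < 1) (ha : ‖a‖ ≤ 1) {r : ℕ}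
    (hA : ‖qPoch a q r‖ ≤ A) (hC : ‖(qPoch q q r)⁻¹‖ ≤ C) (hB : ‖w‖ ≤ B) :
    ‖selbergFactor q a r * w‖ ≤ ‖q‖ ^ r * (A * C * B) := by
  have hA0 := (norm_nonneg _).trans hA
  have hC0 := (norm_nonneg _).trans hC
  rw [selbergFactor]
  simp only [norm_mul, norm_pow, norm_neg, norm_one, one_pow, one_mul]
  have h1 : ‖a‖ ^ (2 * r) * ‖q‖ ^ (5 * r.choose 2 + r) ≤ ‖q‖ ^ r := by
    refine (mul_le_of_le_one_left (by positivity) (pow_le_one₀ (norm_nonneg a) ha)).trans ?_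
    exact pow_le_pow_of_le_one (norm_nonneg q) hq.le (by omega)
  calc _ ≤ ‖q‖ ^ r * A * C * B := by gcongr
    _ = _ := by ring

theorem summable_selbergFactor_mul {q a : ℂ} (hq : ‖q‖ < 1) (ha : ‖a‖ ≤ 1) {w : ℕ → ℂ} {B : ℝ}
    (hw : ∀ r, ‖w r‖ ≤ B) : Summable fun r => selbergFactor q a r * w r := by
  obtain ⟨A, -, hA⟩ := exists_norm_qPoch_le a hq
  obtain ⟨C, -, hC⟩ := exists_norm_qPoch_inv_le hq hq
  exact Summable.of_norm_bounded
    ((summable_geometric_of_lt_one (norm_nonneg q) hq).mul_right (A * C * B))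
    fun r => norm_selbergFactor_mul_le hq ha (hA r) (hC r) (hw r)

theorem norm_one_sub_le_two {z : ℂ} (hz : ‖z‖ ≤ 1) : ‖1 - z‖ ≤ 2 := by
  have := norm_sub_le 1 z
  rw [norm_one] at this
  linarith

theorem norm_mul_pow_le_one {q a : ℂ} (hq : ‖q‖ < 1) (ha : ‖a‖ ≤ 1) (m n : ℕ) :
    ‖a ^ m * q ^ n‖ ≤ 1 := by
  rw [norm_mul, norm_pow, norm_pow]
  exact mul_le_one₀ (pow_le_one₀ (norm_nonneg a) ha) (by positivity)
    (pow_le_one₀ (norm_nonneg q) hq.le)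

theorem summable_selbergOne {q a : ℂ} (hq : ‖q‖ < 1) (ha : ‖a‖ ≤ 1) :
    Summable fun r => selbergFactor q a r * (q ^ r * (1 - a * q ^ (2 * r))) :=
  summable_selbergFactor_mul (B := 1 * 2) hq ha fun r => by
    rw [norm_mul]
    exact mul_le_mul (by simpa using norm_mul_pow_le_one hq ha 0 r)
      (norm_one_sub_le_two (by simpa using norm_mul_pow_le_one hq ha 1 (2 * r)))
      (norm_nonneg _) zero_le_one

theorem summable_selbergTwo {q a : ℂ} (hq : ‖q‖ < 1) (ha : ‖a‖ ≤ 1) :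
    Summable fun r => selbergFactor q a r * (1 - a ^ 2 * q ^ (4 * r)) :=
  summable_selbergFactor_mul (B := 2) hq ha fun r =>
    norm_one_sub_le_two (norm_mul_pow_le_one hq ha 2 (4 * r))

/-- Since `u 0 = 0`, the series of `u` and of its shift have the same sum, so moving `u` one index
along does not change the total. -/
theorem tsum_eq_tsum_of_telescope {t u s : ℕ → ℂ} (ht : Summable t) (hu : Summable u)
    (h0 : u 0 = 0) (h : ∀ r, t r - u r + u (r + 1) = s r) : ∑' r, t r = ∑' r, s r := by
  have hu1 : Summable fun r => u (r + 1) := (summable_nat_add_iff 1).mpr hu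
  have h2 := hu.tsum_eq_zero_add
  rw [h0, zero_add] at h2
  rw [← tsum_congr h, (ht.sub hu).tsum_add hu1, ht.tsum_sub hu, ← h2, sub_add_cancel]

theorem selbergOne_eq {q a : ℂ} (hq : ‖q‖ < 1) (ha : ‖a‖ ≤ 1) :
    selbergOne q a = (1 - a) * selbergTwo q (a * q) := by
  rw [selbergTwo, ← tsum_mul_left]
  -- From `1 - a q^(2r) = (1 - q^r) + q^r (1 - a q^r)`: the first part is `u`, and the second and
  -- the shifted `u` share the factor `1 - a q^r`, which turns `a` into `a q`.
  refine tsum_eq_tsum_of_telescope (u := fun r => selbergFactor q a r * (q ^ r * (1 - q ^ r)))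
    (summable_selbergOne hq ha)
    (summable_selbergFactor_mul (B := 1 * 2) hq ha fun r => ?_) (by simp) fun r => ?_
  · rw [norm_mul]
    exact mul_le_mul (by simpa using norm_mul_pow_le_one hq ha 0 r)
      (norm_one_sub_le_two (by simpa using norm_mul_pow_le_one hq ha 0 r))
      (norm_nonneg _) zero_le_one
  · linear_combination q ^ (r + 1) * selbergFactor_succ_mul hq a r -
      (1 - (a * q) ^ 2 * q ^ (4 * r)) * one_sub_mul_selbergFactor q a r

theorem selbergTwo_eq {q a : ℂ} (hq : ‖q‖ < 1) (ha : ‖a‖ ≤ 1) :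
    selbergTwo q a = selbergOne q a + a * (1 - a) * selbergOne q (a * q) := by
  rw [← sub_eq_iff_eq_add']
  nth_rw 2 [selbergOne]
  rw [selbergTwo, selbergOne, ← (summable_selbergTwo hq ha).tsum_sub (summable_selbergOne hq ha),
    ← tsum_mul_left]
  refine tsum_eq_tsum_of_telescope (u := fun r => selbergFactor q a r * (1 - q ^ r))
    ((summable_selbergTwo hq ha).sub (summable_selbergOne hq ha))
    (summable_selbergFactor_mul (B := 2) hq ha fun r =>
      norm_one_sub_le_two (by simpa using norm_mul_pow_le_one hq ha 0 r)) (by simp) fun r => ?_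
  linear_combination selbergFactor_succ_mul hq a r -
      a * (q ^ r * (1 - a * q * q ^ (2 * r))) * one_sub_mul_selbergFactor q a r

theorem tendsto_selbergTwo {q : ℂ} (hq : ‖q‖ < 1) :
    Tendsto (fun n : ℕ => selbergTwo q (q ^ (n + 1))) atTop (𝓝 1) := by
  obtain ⟨A, -, hA⟩ := exists_norm_qPoch_le q hq
  obtain ⟨C, -, hC⟩ := exists_norm_qPoch_inv_le hq hq
  have hpow : Tendsto (fun n : ℕ => q ^ (n + 1)) atTop (𝓝 0) :=
    (tendsto_pow_atTop_nhds_zero_of_norm_lt_one hq).comp (tendsto_add_atTop_nat 1)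
  have h0 : ∑' r : ℕ, (if r = 0 then (1 : ℂ) else 0) = 1 := tsum_ite_eq 0 _
  rw [← h0]
  refine tendsto_tsum_of_dominated_convergence
    (bound := fun r => ‖q‖ ^ r * (A * C * C * 2))
    ((summable_geometric_of_lt_one (norm_nonneg q) hq).mul_right _) (fun r => ?_)
    (Eventually.of_forall fun n r => ?_)
  · have hc : Continuous fun a => selbergFactor q a r * (1 - a ^ 2 * q ^ (4 * r)) := by
      unfold selbergFactor qPoch
      fun_prop
    have h1 := (hc.tendsto 0).comp hpow
    rcases eq_or_ne r 0 with rfl | hr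
    · simpa [selbergFactor, qPoch_zero, Function.comp_def] using h1
    · simpa [selbergFactor, hr, Function.comp_def] using h1
  · have hn := qPoch_ne_zero hq hq n
    -- Writing the factorial as a quotient of two based at `q` bounds it by `A * C`, uniformly in
    -- `n` and `r`.
    have h1 : qPoch (q ^ (n + 1)) q r = qPoch q q (n + r) * (qPoch q q n)⁻¹ := by
      rw [eq_mul_inv_iff_mul_eq₀ hn, mul_comm, qPoch, qPoch, qPoch, Finset.prod_range_add]
      congr 1
      exact Finset.prod_congr rfl fun k _ => by ring
    refine norm_selbergFactor_mul_le hq (norm_pow_succ_lt_one hq n).le ?_ (hC r)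
      (norm_one_sub_le_two (norm_mul_pow_le_one hq (norm_pow_succ_lt_one hq n).le 2 (4 * r)))
    rw [h1, norm_mul]
    exact mul_le_mul (hA _) (hC _) (norm_nonneg _) ((norm_nonneg _).trans (hA 0))

/-- The recurrence `d n = d (n + 1) + q ^ (n + 1) d (n + 2)` has no nonzero null solution. -/
theorem eq_zero_of_recurrence {q : ℂ} (hq : ‖q‖ < 1) {d : ℕ → ℂ}
    (hd : ∀ n, d n = d (n + 1) + q ^ (n + 1) * d (n + 2)) (h0 : Tendsto d atTop (𝓝 0)) (n : ℕ) :
    d n = 0 := by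
  set r : ℕ → ℝ := fun n => ∏ k ∈ Finset.range n, (1 + ‖q‖ ^ (k + 1)) with hr
  set M : ℕ → ℝ := fun n => max ‖d n‖ ‖d (n + 1)‖ with hM
  have hr0 : ∀ n, 0 < r n := fun n => Finset.prod_pos fun k _ => by positivity
  have hs : Summable fun k : ℕ => ‖‖q‖ ^ (k + 1)‖ := by
    simpa using (summable_nat_add_iff 1).mpr (summable_geometric_of_lt_one (norm_nonneg q) hq)
  have hlim := (multipliable_one_add_of_summable hs).hasProd.tendsto_prod_nat
  have hM0 : Tendsto M atTop (𝓝 0) := by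
    have h1 := h0.norm
    have h2 := h1.max (h1.comp (tendsto_add_atTop_nat 1))
    simpa using h2
  have hlim0 := hlim.mul hM0
  rw [mul_zero] at hlim0
  -- The recurrence gives `M n ≤ (1 + ‖q‖ ^ (n + 1)) * M (n + 1)`, so `r n * M n` increases. It
  -- tends to 0 because the product `r` converges, hence it is never positive.
  have hmono : Monotone fun n => r n * M n := monotone_nat_of_le_succ fun n => by
    have h1 : r (n + 1) = r n * (1 + ‖q‖ ^ (n + 1)) := Finset.prod_range_succ _ _
    rw [h1, mul_assoc]
    refine mul_le_mul_of_nonneg_left ?_ (hr0 n).le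
    have ha : ‖d (n + 1)‖ ≤ M (n + 1) := le_max_left _ _
    have hb : ‖d (n + 2)‖ ≤ M (n + 1) := le_max_right _ _
    have hM1 : 0 ≤ M (n + 1) := (norm_nonneg _).trans ha
    have hq1 : 0 ≤ ‖q‖ ^ (n + 1) := by positivity
    refine max_le ?_ ?_
    · rw [hd n]
      refine (norm_add_le _ _).trans ?_
      rw [norm_mul, norm_pow]
      nlinarith [mul_le_mul_of_nonneg_left hb hq1]
    · nlinarith
  have h1 : r n * M n ≤ 0 := hmono.ge_of_tendsto hlim0 n
  have h2 : M n ≤ 0 := nonpos_of_mul_nonpos_right h1 (hr0 n)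
  exact norm_le_zero_iff.mp ((le_max_left _ _).trans h2)

/-- The Rogers–Ramanujan series `∑ z^n q^(n(n-1)) / (q; q)_n`. -/
noncomputable def ramanujanSeries (q z : ℂ) : ℂ :=
  ∑' n : ℕ, z ^ n * (q ^ (2 * n.choose 2) * (qPoch q q n)⁻¹)

theorem summable_norm_ramanujanSeries {q z : ℂ} (hq : ‖q‖ < 1) (hz : ‖z‖ < 1) :
    Summable fun n : ℕ => ‖z ^ n * (q ^ (2 * n.choose 2) * (qPoch q q n)⁻¹)‖ := by
  refine Summable.of_nonneg_of_le (fun _ => norm_nonneg _) (fun n => ?_)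
    (summable_norm_pow_div_qPoch hq hz)
  simp only [norm_mul, norm_pow]
  gcongr
  exact mul_le_of_le_one_left (norm_nonneg _) (pow_le_one₀ (norm_nonneg q) hq.le)

theorem ramanujanSeries_recurrence {q z : ℂ} (hq : ‖q‖ < 1) (hz : ‖z‖ < 1) :
    ramanujanSeries q z = ramanujanSeries q (z * q) + z * ramanujanSeries q (z * q ^ 2) := by
  have hle : ∀ n : ℕ, ‖z * q ^ n‖ < 1 := norm_mul_pow_lt_one hq hz
  have s1 := (summable_norm_ramanujanSeries hq hz).of_norm
  have s2 := (summable_norm_ramanujanSeries hq (by simpa using hle 1 : ‖z * q‖ < 1)).of_norm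
  rw [← sub_eq_iff_eq_add', ramanujanSeries, ramanujanSeries, ramanujanSeries, ← s1.tsum_sub s2,
    (s1.sub s2).tsum_eq_zero_add, ← tsum_mul_left]
  simp only [pow_zero, sub_self, zero_add]
  refine tsum_congr fun n => ?_
  have h := qPoch_ne_zero hq hq (n + 1)
  rw [qPoch_self_succ] at h ⊢
  have h1 := left_ne_zero_of_mul h
  have h2 := right_ne_zero_of_mul h
  rw [Nat.succ_choose_two]
  field_simp
  ring

/-- Eliminating `selbergOne` between `selbergTwo_eq` and `selbergOne_eq`, then dividing by `(a;
q)_∞`, gives the recurrence of `ramanujanSeries`. The difference of the two sides is a null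
solution. -/
theorem ramanujanSeries_pow_eq {q : ℂ} (hq : ‖q‖ < 1) (n : ℕ) :
    ramanujanSeries q (q ^ (n + 1)) =
      selbergTwo q (q ^ (n + 1)) / qPochInf (q ^ (n + 1)) q := by
  refine sub_eq_zero.mp (eq_zero_of_recurrence hq (d := fun n => ramanujanSeries q (q ^ (n + 1)) -
      selbergTwo q (q ^ (n + 1)) / qPochInf (q ^ (n + 1)) q) (fun n => ?_) ?_ n)
  · have hn : ∀ k, q ^ (k + 1) * q = q ^ (k + 1 + 1) := fun k => (pow_succ _ _).symm
    have e1 := ramanujanSeries_recurrence hq (norm_pow_succ_lt_one hq n)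
    have e2 := selbergTwo_eq hq (norm_pow_succ_lt_one hq n).le
    have e3 := selbergOne_eq hq (norm_pow_succ_lt_one hq n).le
    have e4 := selbergOne_eq hq (norm_pow_succ_lt_one hq (n + 1)).le
    have p1 := qPochInf_eq_one_sub_mul (q ^ (n + 1)) hq
    have p2 := qPochInf_eq_one_sub_mul (q ^ (n + 1 + 1)) hq
    have z1 := qPochInf_ne_zero_of_norm_lt_one hq (norm_pow_succ_lt_one hq n)
    rw [show q ^ (n + 1) * q ^ 2 = q ^ (n + 2 + 1) by ring] at e1
    rw [hn] at e1 e2 e3 e4 p1 p2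
    rw [e4, e3] at e2
    rw [p1, p2] at z1
    have z2 := left_ne_zero_of_mul z1
    have z3 := left_ne_zero_of_mul (right_ne_zero_of_mul z1)
    have z4 := right_ne_zero_of_mul (right_ne_zero_of_mul z1)
    rw [e1, e2, p1, p2]
    field_simp
    ring
  · have h1 := tendsto_tsum_mul_pow hq (summable_norm_ramanujanSeries hq hq)
    have h2 := (tendsto_selbergTwo hq).div
      (tendsto_qPochInf_mul_pow q hq (qPochInf_ne_zero_of_norm_lt_one hq hq)) one_ne_zero
    simpa [ramanujanSeries, pow_succ', qPoch_zero] using h1.sub h2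

/-! ### Theta evaluations and the Rogers–Ramanujan identities -/

/-- The triple product in base `q ^ 5` at `x = q ^ s`, with the terms of index `r` and `-(r + 1)`
paired. -/
theorem hasSum_theta_pow_five {q : ℂ} (hq : ‖q‖ < 1) (hq0 : q ≠ 0) {s t : ℕ} (hs : s ≠ 0)
    (hst : s + t = 5) :
    HasSum (fun r : ℕ => (-1) ^ r * q ^ (5 * r.choose 2 + s * r) * (1 - q ^ (t * (2 * r + 1))))
      (qPochInf (q ^ 5) (q ^ 5) * (qPochInf (q ^ s) (q ^ 5) * qPochInf (q ^ t) (q ^ 5))) := by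
  have hx : ‖q ^ s‖ < 1 := by
    rw [norm_pow]
    exact pow_lt_one₀ (norm_nonneg q) hq hs
  have hdiv : q ^ 5 / q ^ s = q ^ t := by
    rw [← hst, pow_add, mul_div_cancel_left₀ _ (pow_ne_zero s hq0)]
  have h := (hasSum_jacobi_triple (norm_pow_succ_lt_one hq 4) (pow_ne_zero 5 hq0) hx
    (pow_ne_zero s hq0)).nat_add_neg_add_one
  rw [hdiv] at h
  refine h.congr_fun fun r => ?_
  have h1 : thetaTerm (q ^ 5) (q ^ s) (-((r : ℤ) + 1)) =
      (-(q ^ t)) ^ (r + 1) * (q ^ 5) ^ (r + 1).choose 2 := by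
    rw [← hdiv]
    exact_mod_cast thetaTerm_neg_natCast (pow_ne_zero 5 hq0) (q ^ s) (r + 1)
  have h2 : q ^ (5 * r.choose 2 + s * r) * q ^ (t * (2 * r + 1)) =
      (q ^ t) ^ (r + 1) * (q ^ 5) ^ (r + 1).choose 2 := by
    rw [← pow_mul, ← pow_mul, ← pow_add, ← pow_add, Nat.succ_choose_two, ← hst]
    congr 1
    ring
  rw [thetaTerm_natCast, h1, neg_pow, neg_pow (q ^ t), mul_assoc ((-1) ^ (r + 1)), ← h2]
  ring

/-- At `a = q` the ratio `(a; q)_r / (q; q)_r` is 1, so only a theta series remains. -/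
theorem selbergTwo_self {q : ℂ} (hq : ‖q‖ < 1) (hq0 : q ≠ 0) :
    selbergTwo q q =
      qPochInf (q ^ 5) (q ^ 5) * (qPochInf (q ^ 3) (q ^ 5) * qPochInf (q ^ 2) (q ^ 5)) := by
  rw [← (hasSum_theta_pow_five hq hq0 (s := 3) (t := 2) (by norm_num) rfl).tsum_eq, selbergTwo]
  refine tsum_congr fun r => ?_
  have := qPoch_ne_zero hq hq r
  rw [selbergFactor]
  field_simp
  ring

theorem selbergOne_self {q : ℂ} (hq : ‖q‖ < 1) (hq0 : q ≠ 0) :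
    selbergOne q q =
      qPochInf (q ^ 5) (q ^ 5) * (qPochInf (q ^ 4) (q ^ 5) * qPochInf (q ^ 1) (q ^ 5)) := by
  rw [← (hasSum_theta_pow_five hq hq0 (s := 4) (t := 1) (by norm_num) rfl).tsum_eq, selbergOne]
  refine tsum_congr fun r => ?_
  have := qPoch_ne_zero hq hq r
  rw [selbergFactor]
  field_simp
  ring

theorem qPochInf_self_eq_prod_five {q : ℂ} (hq : ‖q‖ < 1) :
    qPochInf q q = qPochInf (q ^ 1) (q ^ 5) * qPochInf (q ^ 2) (q ^ 5) * qPochInf (q ^ 3) (q ^ 5) *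
      qPochInf (q ^ 4) (q ^ 5) * qPochInf (q ^ 5) (q ^ 5) := by
  rw [qPochInf_eq_prod q hq (m := 5) (by norm_num)]
  simp only [Finset.prod_range_succ, Finset.prod_range_zero, one_mul, ← pow_succ']

/-- The first **Rogers–Ramanujan identity**. -/
theorem rogersRamanujan_one {q : ℂ} (hq : ‖q‖ < 1) (hq0 : q ≠ 0) :
    HasSum (fun n : ℕ => q ^ n ^ 2 * (qPoch q q n)⁻¹)
      (1 / (qPochInf q (q ^ 5) * qPochInf (q ^ 4) (q ^ 5))) := by
  have hnz : ∀ k, qPochInf (q ^ (k + 1)) (q ^ 5) ≠ 0 := fun k =>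
    qPochInf_ne_zero_of_norm_lt_one (norm_pow_succ_lt_one hq 4) (norm_pow_succ_lt_one hq k)
  have hval : ramanujanSeries q q = 1 / (qPochInf q (q ^ 5) * qPochInf (q ^ 4) (q ^ 5)) := by
    have h := ramanujanSeries_pow_eq hq 0
    rw [zero_add, pow_one, selbergTwo_self hq hq0, qPochInf_self_eq_prod_five hq] at h
    have h1 := hnz 0
    have h2 := hnz 1
    have h3 := hnz 2
    have h4 := hnz 3
    have h5 := hnz 4
    norm_num at h1 h2 h3 h4 h5
    rw [h, pow_one]
    field_simp
  rw [← hval]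
  refine (summable_norm_ramanujanSeries hq hq).of_norm.hasSum.congr_fun fun n => ?_
  rw [← mul_assoc, ← pow_add]
  congr 2
  rw [Nat.choose_two_right, Nat.mul_div_cancel' (Nat.even_mul_pred_self n).two_dvd]
  rcases n with _ | n
  · rfl
  · rw [Nat.add_sub_cancel]
    ring

/-- The second **Rogers–Ramanujan identity**. -/
theorem rogersRamanujan_two {q : ℂ} (hq : ‖q‖ < 1) (hq0 : q ≠ 0) :
    HasSum (fun n : ℕ => q ^ (n ^ 2 + n) * (qPoch q q n)⁻¹)
      (1 / (qPochInf (q ^ 2) (q ^ 5) * qPochInf (q ^ 3) (q ^ 5))) := by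
  have hnz : ∀ k, qPochInf (q ^ (k + 1)) (q ^ 5) ≠ 0 := fun k =>
    qPochInf_ne_zero_of_norm_lt_one (norm_pow_succ_lt_one hq 4) (norm_pow_succ_lt_one hq k)
  have hval : ramanujanSeries q (q ^ 2) =
      1 / (qPochInf (q ^ 2) (q ^ 5) * qPochInf (q ^ 3) (q ^ 5)) := by
    have h : ramanujanSeries q (q ^ 2) = selbergTwo q (q ^ 2) / qPochInf (q ^ 2) q :=
      ramanujanSeries_pow_eq hq 1
    have hq1 : 1 - q ≠ 0 := by simpa using one_sub_mul_pow_ne_zero hq hq 0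
    have hK := selbergOne_eq hq hq.le
    have hP := qPochInf_eq_one_sub_mul q hq
    rw [← pow_two] at hK hP
    -- Multiplying numerator and denominator by `1 - q` gives `selbergOne q q / (q; q)_∞`, where the
    -- theta evaluation at `a = q` is available.
    rw [← mul_div_mul_left _ _ hq1, ← hK, ← hP, selbergOne_self hq hq0,
      qPochInf_self_eq_prod_five hq] at h
    have h1 := hnz 0
    have h2 := hnz 1
    have h3 := hnz 2
    have h4 := hnz 3
    have h5 := hnz 4
    norm_num at h1 h2 h3 h4 h5
    rw [h, pow_one]
    field_simp
  rw [← hval]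
  refine (summable_norm_ramanujanSeries hq (norm_pow_succ_lt_one hq 1)).of_norm.hasSum.congr_fun
    fun n => ?_
  rw [← mul_assoc, ← pow_mul, ← pow_add]
  congr 2
  rw [Nat.choose_two_right, Nat.mul_div_cancel' (Nat.even_mul_pred_self n).two_dvd]
  rcases n with _ | n
  · rfl
  · rw [Nat.add_sub_cancel]
    ring

/-! ### Parity splitting and the double series -/

theorem HasSum.even_part {b A B : ℂ} {c : ℕ → ℂ} (hA : HasSum (fun n => b ^ n * c n) A)
    (hB : HasSum (fun n => (-b) ^ n * c n) B) :
    HasSum (fun m => b ^ (2 * m) * c (2 * m)) ((A + B) / 2) := by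
  have h := (hA.add hB).div_const 2
  rw [← (mul_right_injective₀ (two_ne_zero (α := ℕ))).hasSum_iff fun n hn => ?_] at h
  · refine h.congr_fun fun m => ?_
    simp only [Function.comp_apply, (even_two_mul m).neg_pow]
    ring
  · have hodd : Odd n := by
      rw [← Nat.not_even_iff_odd]
      rintro ⟨k, rfl⟩
      exact hn ⟨k, two_mul k⟩
    rw [hodd.neg_pow]
    ring

theorem HasSum.odd_part {b A B : ℂ} {c : ℕ → ℂ} (hA : HasSum (fun n => b ^ n * c n) A)
    (hB : HasSum (fun n => (-b) ^ n * c n) B) :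
    HasSum (fun m => b ^ (2 * m + 1) * c (2 * m + 1)) ((A - B) / 2) := by
  have h := (hA.sub hB).div_const 2
  have hinj : Function.Injective fun m : ℕ => 2 * m + 1 := fun m n hmn => by
    simpa using hmn
  rw [← hinj.hasSum_iff fun n hn => ?_] at h
  · refine h.congr_fun fun m => ?_
    simp only [Function.comp_apply, (odd_two_mul_add_one m).neg_pow]
    ring
  · have heven : Even n := by
      rw [← Nat.not_odd_iff_even]
      rintro ⟨k, rfl⟩
      exact hn ⟨k, rfl⟩
    rw [heven.neg_pow]
    ring

/-- Both series are iterated sums of one absolutely convergent double series: Euler's expansion of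
`(-b q^j; q)_∞` sums over `k`, that of `1 / (q^(k+t+1); q^2)_∞` sums over `j`. The common value `W`
never needs a closed form. -/
theorem exists_hasSum_qPochInf_series {q : ℂ} (hq : ‖q‖ < 1) (b : ℂ) (t : ℕ) :
    ∃ W : ℂ,
      HasSum (fun j : ℕ => q ^ ((t + 1) * j) * (qPoch (q ^ 2) (q ^ 2) j)⁻¹ *
        qPochInf (-(b * q ^ j)) q) W ∧
      HasSum (fun k : ℕ => b ^ k * (q ^ k.choose 2 * (qPoch q q k)⁻¹ *
        (qPochInf (q ^ (k + t + 1)) (q ^ 2))⁻¹)) W := by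
  have hq2 := norm_pow_succ_lt_one hq 1
  set E : ℕ × ℕ → ℂ := fun p => b ^ p.1 * (q ^ p.1.choose 2 * (qPoch q q p.1)⁻¹) *
    (q ^ ((p.1 + t + 1) * p.2) * (qPoch (q ^ 2) (q ^ 2) p.2)⁻¹) with hE
  have hs : Summable E := by
    obtain ⟨C, hC0, hC⟩ := exists_norm_qPoch_inv_le hq2 hq2
    have h1 := (summable_norm_euler hq b).mul_of_nonneg
      ((summable_geometric_of_lt_one (norm_nonneg q) hq).mul_right C)
      (fun _ => norm_nonneg _) (fun _ => by positivity)
    refine Summable.of_norm_bounded h1 fun p => ?_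
    rw [hE, norm_mul, norm_mul (q ^ _), norm_pow]
    refine mul_le_mul_of_nonneg_left (mul_le_mul ?_ (hC _) (norm_nonneg _) (by positivity))
      (norm_nonneg _)
    exact pow_le_pow_of_le_one (norm_nonneg q) hq.le (by nlinarith)
  have hcol : ∀ j, HasSum (fun k => E (k, j)) (q ^ ((t + 1) * j) *
      (qPoch (q ^ 2) (q ^ 2) j)⁻¹ * qPochInf (-(b * q ^ j)) q) := fun j => by
    refine ((hasSum_qPochInf_neg hq (b * q ^ j)).mul_left _).congr_fun fun k => ?_
    rw [hE]
    ring
  have hrow : ∀ k, HasSum (fun j => E (k, j)) (b ^ k * (q ^ k.choose 2 * (qPoch q q k)⁻¹ *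
        (qPochInf (q ^ (k + t + 1)) (q ^ 2))⁻¹)) := fun k => by
    rw [← mul_assoc]
    refine ((hasSum_pow_div_qPoch hq2 (norm_pow_succ_lt_one hq (k + t))).mul_left _).congr_fun
      fun j => ?_
    rw [hE]
    ring
  refine ⟨∑' p, E p, ?_, hs.hasSum.prod_fiberwise hrow⟩
  have h : HasSum (fun p : ℕ × ℕ => E (p.2, p.1)) (∑' p, E p) :=
    (Equiv.prodComm ℕ ℕ).hasSum_iff.mpr hs.hasSum
  exact h.prod_fiberwise hcol

theorem inv_qPoch_mul_inv_qPochInf {q b : ℂ} (hq : ‖q‖ < 1) (hb : b ^ 2 = q) (hb1 : ‖b‖ < 1)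
    (j : ℕ) : (qPoch q q (2 * j))⁻¹ * (qPochInf (b * q ^ j) q)⁻¹ =
      (qPochInf q (q ^ 2))⁻¹ * ((qPoch (q ^ 2) (q ^ 2) j)⁻¹ * qPochInf (-(b * q ^ j)) q) := by
  have hq2 := norm_pow_succ_lt_one hq 1
  have hbj : ‖b * q ^ j‖ < 1 := norm_mul_pow_lt_one hq hb1 j
  have h1 := qPochInf_mul_neg (b * q ^ j) hq
  rw [show (b * q ^ j) ^ 2 = q * (q ^ 2) ^ j by rw [mul_pow, hb]; ring] at h1
  rw [qPoch_two_mul, ← qPoch_mul_qPochInf q hq2 j, ← h1]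
  have z1 := qPoch_ne_zero hq2 hq j
  have z2 := qPoch_ne_zero hq2 hq2 j
  have z3 := qPochInf_ne_zero_of_norm_lt_one hq hbj
  have z4 := qPochInf_ne_zero_of_norm_lt_one hq (by rwa [norm_neg] : ‖-(b * q ^ j)‖ < 1)
  field_simp

theorem summable_pow_mul_inv_qPoch {q : ℂ} (hq : ‖q‖ < 1) {e : ℕ × ℕ → ℕ} (m n : ℕ → ℕ)
    (he : ∀ p, p.1 + p.2 ≤ e p) :
    Summable fun p : ℕ × ℕ => q ^ e p / (qPoch q q (m p.1) * qPoch q q (n p.2)) := by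
  obtain ⟨C, hC0, hC⟩ := exists_norm_qPoch_inv_le hq hq
  have hg := (summable_geometric_of_lt_one (norm_nonneg q) hq).mul_right C
  refine Summable.of_norm_bounded (hg.mul_of_nonneg hg (fun _ => by positivity)
    (fun _ => by positivity)) fun p => ?_
  rw [div_eq_mul_inv, mul_inv, norm_mul, norm_mul, norm_pow]
  calc _ ≤ ‖q‖ ^ (p.1 + p.2) * (C * C) := by
        refine mul_le_mul (pow_le_pow_of_le_one (norm_nonneg q) hq.le (he p))
          (mul_le_mul (hC _) (hC _) (norm_nonneg _) hC0.le) (by positivity) (by positivity)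
    _ = _ := by rw [pow_add]; ring

theorem hasSum_even_double {q : ℂ} (hq : ‖q‖ < 1) (hq0 : q ≠ 0) :
    HasSum (fun p : ℕ × ℕ =>
        q ^ (2 * p.1 * p.2 + p.1 + p.2) / (qPoch q q (2 * p.1) * qPoch q q (2 * p.2)))
      (1 / (qPochInf q (q ^ 2) ^ 2 *
        (qPochInf (q ^ 2) (q ^ 10) * qPochInf (q ^ 8) (q ^ 10)))) := by
  have hq2 := norm_pow_succ_lt_one hq 1
  obtain ⟨b, hb⟩ := IsAlgClosed.exists_pow_nat_eq q (n := 2) (by norm_num)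
  have hb1 : ‖b‖ < 1 := by
    rw [← hb, norm_pow] at hq
    exact (pow_lt_one_iff_of_nonneg (norm_nonneg b) two_ne_zero).mp hq
  have hbj : ∀ j, ‖b * q ^ j‖ < 1 := norm_mul_pow_lt_one hq hb1
  obtain ⟨W, hW1, hW2⟩ := exists_hasSum_qPochInf_series hq b 0
  obtain ⟨W', hW1', hW2'⟩ := exists_hasSum_qPochInf_series hq (-b) 0
  -- In the even part in `b`, `(q; q)_{2m} (q^(2m+1); q^2)_∞ = (q^2; q^2)_m (q; q^2)_∞`, which
  -- leaves the first Rogers–Ramanujan sum in base `q^2`.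
  have hval : (W + W') / 2 = (qPochInf q (q ^ 2))⁻¹ *
      (1 / (qPochInf (q ^ 2) (q ^ 10) * qPochInf (q ^ 8) (q ^ 10))) := by
    refine (hW2.even_part hW2').unique ?_
    have hRR := rogersRamanujan_one hq2 (pow_ne_zero 2 hq0)
    rw [← pow_mul, ← pow_mul] at hRR
    refine (hRR.mul_left (qPochInf q (q ^ 2))⁻¹).congr_fun fun m => ?_
    have hexp : q ^ m * q ^ (2 * m).choose 2 = (q ^ 2) ^ m ^ 2 := by
      rw [← pow_mul, ← pow_add, Nat.choose_two_right, mul_assoc, Nat.mul_div_cancel_left _ two_pos]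
      congr 1
      rcases m with _ | m
      · rfl
      · rw [show 2 * (m + 1) - 1 = 2 * m + 1 by omega]
        ring
    rw [← qPoch_mul_qPochInf q hq2 m, qPoch_two_mul, pow_mul, hb, ← hexp,
      show q ^ (2 * m + 0 + 1) = q * (q ^ 2) ^ m by ring]
    simp only [mul_inv]
    ring
  have hrow : ∀ j : ℕ, HasSum (fun i : ℕ =>
      q ^ (2 * i * j + i + j) / (qPoch q q (2 * i) * qPoch q q (2 * j)))
      ((qPochInf q (q ^ 2))⁻¹ * ((q ^ ((0 + 1) * j) * (qPoch (q ^ 2) (q ^ 2) j)⁻¹ *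
        qPochInf (-(b * q ^ j)) q + q ^ ((0 + 1) * j) * (qPoch (q ^ 2) (q ^ 2) j)⁻¹ *
        qPochInf (-(-b * q ^ j)) q) / 2)) := fun j => by
    have h1 := hasSum_pow_div_qPoch hq (hbj j)
    have h2 := hasSum_pow_div_qPoch hq (z := -b * q ^ j) (by simpa using hbj j)
    simp only [mul_pow _ (q ^ j), mul_assoc _ ((q ^ j) ^ _)] at h1 h2
    have h3 := (h1.even_part h2).mul_left (q ^ j * (qPoch q q (2 * j))⁻¹)
    have e1 := inv_qPoch_mul_inv_qPochInf hq hb hb1 j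
    have e2 := inv_qPoch_mul_inv_qPochInf hq (b := -b) (by rw [neg_sq, hb])
      (by rwa [norm_neg]) j
    rw [show (qPochInf q (q ^ 2))⁻¹ * ((q ^ ((0 + 1) * j) * (qPoch (q ^ 2) (q ^ 2) j)⁻¹ *
        qPochInf (-(b * q ^ j)) q + q ^ ((0 + 1) * j) * (qPoch (q ^ 2) (q ^ 2) j)⁻¹ *
        qPochInf (-(-b * q ^ j)) q) / 2) = q ^ j * (qPoch q q (2 * j))⁻¹ *
        (((qPochInf (b * q ^ j) q)⁻¹ + (qPochInf (-b * q ^ j) q)⁻¹) / 2) by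
      rw [zero_add, one_mul]
      linear_combination (-q ^ j / 2) * (e1 + e2)]
    refine h3.congr_fun fun i => ?_
    rw [pow_mul b, hb, div_eq_mul_inv, mul_inv]
    ring
  have hs := summable_pow_mul_inv_qPoch hq (e := fun p => 2 * p.1 * p.2 + p.1 + p.2)
    (fun i => 2 * i) (fun j => 2 * j) fun p => by nlinarith [Nat.zero_le (p.1 * p.2)]
  have hswap : HasSum (fun p : ℕ × ℕ =>
      q ^ (2 * p.2 * p.1 + p.2 + p.1) / (qPoch q q (2 * p.2) * qPoch q q (2 * p.1)))
      (∑' p : ℕ × ℕ, q ^ (2 * p.1 * p.2 + p.1 + p.2) /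
        (qPoch q q (2 * p.1) * qPoch q q (2 * p.2))) :=
    (Equiv.prodComm ℕ ℕ).hasSum_iff.mpr hs.hasSum
  have h := (hswap.prod_fiberwise hrow).unique
    (((hW1.add hW1').div_const 2).mul_left (qPochInf q (q ^ 2))⁻¹)
  rw [hval] at h
  rw [show (1 : ℂ) / (qPochInf q (q ^ 2) ^ 2 *
        (qPochInf (q ^ 2) (q ^ 10) * qPochInf (q ^ 8) (q ^ 10))) =
      (qPochInf q (q ^ 2))⁻¹ * ((qPochInf q (q ^ 2))⁻¹ *
        (1 / (qPochInf (q ^ 2) (q ^ 10) * qPochInf (q ^ 8) (q ^ 10)))) by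
    simp only [one_div, mul_inv]
    ring, ← h]
  exact hs.hasSum

theorem hasSum_odd_double {q : ℂ} (hq : ‖q‖ < 1) (hq0 : q ≠ 0) :
    HasSum (fun p : ℕ × ℕ =>
        q ^ (2 * p.1 * p.2 + p.1 + 3 * p.2) / (qPoch q q (2 * p.1 + 1) * qPoch q q (2 * p.2)))
      (1 / (qPochInf q (q ^ 2) ^ 2 *
        (qPochInf (q ^ 4) (q ^ 10) * qPochInf (q ^ 6) (q ^ 10)))) := by
  have hq2 := norm_pow_succ_lt_one hq 1
  obtain ⟨b, hb⟩ := IsAlgClosed.exists_pow_nat_eq q (n := 2) (by norm_num)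
  have hb1 : ‖b‖ < 1 := by
    rw [← hb, norm_pow] at hq
    exact (pow_lt_one_iff_of_nonneg (norm_nonneg b) two_ne_zero).mp hq
  have hbj : ∀ j, ‖b * q ^ j‖ < 1 := norm_mul_pow_lt_one hq hb1
  have hb0 : b ≠ 0 := by
    rintro rfl
    exact hq0 (by rw [← hb]; norm_num)
  -- Here `t = 1`: writing `q^(2ij+i+3j)` as `b⁻¹ q^(2j) (b q^j)^(2i+1)` leaves the weight `q^(2j)`.
  obtain ⟨W, hW1, hW2⟩ := exists_hasSum_qPochInf_series hq b 1
  obtain ⟨W', hW1', hW2'⟩ := exists_hasSum_qPochInf_series hq (-b) 1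
  have hval : b⁻¹ * ((W - W') / 2) = (qPochInf q (q ^ 2))⁻¹ *
      (1 / (qPochInf (q ^ 4) (q ^ 10) * qPochInf (q ^ 6) (q ^ 10))) := by
    refine ((hW2.odd_part hW2').mul_left b⁻¹).unique ?_
    have hRR := rogersRamanujan_two hq2 (pow_ne_zero 2 hq0)
    rw [← pow_mul, ← pow_mul, ← pow_mul] at hRR
    refine (hRR.mul_left (qPochInf q (q ^ 2))⁻¹).congr_fun fun m => ?_
    have hexp : q ^ m * q ^ (2 * m + 1).choose 2 = (q ^ 2) ^ (m ^ 2 + m) := by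
      rw [← pow_mul, ← pow_add, Nat.choose_two_right, Nat.add_sub_cancel, mul_left_comm,
        Nat.mul_div_cancel_left _ two_pos]
      ring
    have hb2 : b⁻¹ * b ^ (2 * m + 1) = q ^ m := by
      rw [pow_succ, mul_comm, mul_assoc, mul_inv_cancel₀ hb0, mul_one, pow_mul, hb]
    rw [← mul_assoc, hb2, ← qPoch_mul_qPochInf q hq2 (m + 1), qPoch_two_mul_add_one, ← hexp,
      show q ^ (2 * m + 1 + 1 + 1) = q * (q ^ 2) ^ (m + 1) by ring]
    simp only [mul_inv]
    ring
  have hrow : ∀ j : ℕ, HasSum (fun i : ℕ =>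
      q ^ (2 * i * j + i + 3 * j) / (qPoch q q (2 * i + 1) * qPoch q q (2 * j)))
      ((qPochInf q (q ^ 2))⁻¹ * (b⁻¹ * ((q ^ ((1 + 1) * j) * (qPoch (q ^ 2) (q ^ 2) j)⁻¹ *
        qPochInf (-(b * q ^ j)) q - q ^ ((1 + 1) * j) * (qPoch (q ^ 2) (q ^ 2) j)⁻¹ *
        qPochInf (-(-b * q ^ j)) q) / 2))) := fun j => by
    have h1 := hasSum_pow_div_qPoch hq (hbj j)
    have h2 := hasSum_pow_div_qPoch hq (z := -b * q ^ j) (by simpa using hbj j)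
    simp only [mul_pow _ (q ^ j), mul_assoc _ ((q ^ j) ^ _)] at h1 h2
    have h3 := (h1.odd_part h2).mul_left (b⁻¹ * q ^ (2 * j) * (qPoch q q (2 * j))⁻¹)
    have e1 := inv_qPoch_mul_inv_qPochInf hq hb hb1 j
    have e2 := inv_qPoch_mul_inv_qPochInf hq (b := -b) (by rw [neg_sq, hb])
      (by rwa [norm_neg]) j
    rw [show (qPochInf q (q ^ 2))⁻¹ * (b⁻¹ * ((q ^ ((1 + 1) * j) * (qPoch (q ^ 2) (q ^ 2) j)⁻¹ *
        qPochInf (-(b * q ^ j)) q - q ^ ((1 + 1) * j) * (qPoch (q ^ 2) (q ^ 2) j)⁻¹ *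
        qPochInf (-(-b * q ^ j)) q) / 2)) = b⁻¹ * q ^ (2 * j) * (qPoch q q (2 * j))⁻¹ *
        (((qPochInf (b * q ^ j) q)⁻¹ - (qPochInf (-b * q ^ j) q)⁻¹) / 2) by
      rw [one_add_one_eq_two]
      linear_combination (-b⁻¹ * q ^ (2 * j) / 2) * (e1 - e2)]
    refine h3.congr_fun fun i => ?_
    have hb2 : b⁻¹ * b ^ (2 * i + 1) = q ^ i := by
      rw [pow_succ, mul_comm, mul_assoc, mul_inv_cancel₀ hb0, mul_one, pow_mul, hb]
    rw [show b⁻¹ * q ^ (2 * j) * (qPoch q q (2 * j))⁻¹ *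
        (b ^ (2 * i + 1) * ((q ^ j) ^ (2 * i + 1) * (qPoch q q (2 * i + 1))⁻¹)) =
        b⁻¹ * b ^ (2 * i + 1) * (q ^ (2 * j) * (qPoch q q (2 * j))⁻¹ *
        ((q ^ j) ^ (2 * i + 1) * (qPoch q q (2 * i + 1))⁻¹)) by ring, hb2, div_eq_mul_inv, mul_inv]
    ring
  have hs := summable_pow_mul_inv_qPoch hq (e := fun p => 2 * p.1 * p.2 + p.1 + 3 * p.2)
    (fun i => 2 * i + 1) (fun j => 2 * j) fun p => by nlinarith [Nat.zero_le (p.1 * p.2)]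
  have hswap : HasSum (fun p : ℕ × ℕ =>
      q ^ (2 * p.2 * p.1 + p.2 + 3 * p.1) / (qPoch q q (2 * p.2 + 1) * qPoch q q (2 * p.1)))
      (∑' p : ℕ × ℕ, q ^ (2 * p.1 * p.2 + p.1 + 3 * p.2) /
        (qPoch q q (2 * p.1 + 1) * qPoch q q (2 * p.2))) :=
    (Equiv.prodComm ℕ ℕ).hasSum_iff.mpr hs.hasSum
  have h := (hswap.prod_fiberwise hrow).unique
    ((((hW1.sub hW1').div_const 2).mul_left b⁻¹).mul_left (qPochInf q (q ^ 2))⁻¹)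
  rw [hval] at h
  rw [show (1 : ℂ) / (qPochInf q (q ^ 2) ^ 2 *
        (qPochInf (q ^ 4) (q ^ 10) * qPochInf (q ^ 6) (q ^ 10))) =
      (qPochInf q (q ^ 2))⁻¹ * ((qPochInf q (q ^ 2))⁻¹ *
        (1 / (qPochInf (q ^ 4) (q ^ 10) * qPochInf (q ^ 6) (q ^ 10)))) by
    simp only [one_div, mul_inv]
    ring, ← h]
  exact hs.hasSum

/-! ### The degenerate case `q = 0` and the conclusion -/

theorem qPochInf_zero_left (q : ℂ) : qPochInf 0 q = 1 := by simp [qPochInf]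

theorem hasSum_zero_pow {e : ℕ × ℕ → ℕ} (m n : ℕ → ℕ) (he : ∀ p, p ≠ 0 → e p ≠ 0)
    (he0 : e 0 = 0) :
    HasSum (fun p : ℕ × ℕ => (0 : ℂ) ^ e p / (qPoch 0 0 (m p.1) * qPoch 0 0 (n p.2))) 1 := by
  have h : ∀ k, qPoch 0 0 k = 1 := fun k => by simp [qPoch]
  simp only [h, mul_one, div_one]
  convert hasSum_single (f := fun p : ℕ × ℕ => (0 : ℂ) ^ e p) 0
    (fun p hp => zero_pow (he p hp)) using 1
  rw [he0, pow_zero]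

theorem theorem1p1 (q : ℂ) (hq : ‖q‖ < 1) :
    HasSum
      (fun p : ℕ × ℕ =>
        q ^ (2 * p.1 * p.2 + p.1 + p.2) / (qPoch q q (2 * p.1) * qPoch q q (2 * p.2)))
      (1 / (qPochInf q (q ^ 2) ^ 2 *
        (qPochInf (q ^ 2) (q ^ 10) * qPochInf (q ^ 8) (q ^ 10)))) ∧
    HasSum
      (fun p : ℕ × ℕ =>
        q ^ (2 * p.1 * p.2 + p.1 + 3 * p.2) / (qPoch q q (2 * p.1 + 1) * qPoch q q (2 * p.2)))
      (1 / (qPochInf q (q ^ 2) ^ 2 *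
        (qPochInf (q ^ 4) (q ^ 10) * qPochInf (q ^ 6) (q ^ 10)))) := by
  rcases eq_or_ne q 0 with rfl | hq0
  -- The triple product divides by powers of `q`, so `q = 0` is separate: only the term at the
  -- origin survives, with `0 ^ 0 = 1`.
  · have he : ∀ p : ℕ × ℕ, p ≠ 0 → p.1 ≠ 0 ∨ p.2 ≠ 0 := fun p hp => by
      by_contra! h
      exact hp (Prod.ext h.1 h.2)
    simp only [ne_eq, OfNat.ofNat_ne_zero, not_false_eq_true, zero_pow, qPochInf_zero_left, one_pow,
      mul_one, div_one]
    exact ⟨hasSum_zero_pow (e := fun p => 2 * p.1 * p.2 + p.1 + p.2) (fun i => 2 * i)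
        (fun j => 2 * j) (fun p hp => by rcases he p hp with h | h <;> omega) rfl,
      hasSum_zero_pow (e := fun p => 2 * p.1 * p.2 + p.1 + 3 * p.2) (fun i => 2 * i + 1)
        (fun j => 2 * j) (fun p hp => by rcases he p hp with h | h <;> omega) rfl⟩
  · exact ⟨hasSum_even_double hq hq0, hasSum_odd_double hq hq0⟩
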